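/- Let $(X,\Sigma,\mu)$ be a measure space that is semi-finite, i.e., every $A\in\Sigma$ with $\mu(A)=\infty$ has a measurable subset $A_0$ with $0<\mu(A_0)<\infty$. Let $\mathrm{L}^0(X,\Sigma,\mu)$ be the vector lattice of real-valued measurable functions on $X$, modulo $\mu$-almost everywhere equality, and let $E$ be the ideal in $\mathrm{L}^0(X,\Sigma,\mu)$ of (classes of) functions $f$ whose support $\{t: f(t)\neq 0\}$ is $\sigma$-finite. A net $(f_\alpha)_{\alpha\in A}$ in $\mathrm{L}^0(X,\Sigma,\mu)$ converges locally in measure to $f$ if $\lim_\alpha\mu(\{t\in S: |f_\alpha(t)-f(t)|\geq\varepsilon\})=0$ for every $\varepsilon>0$ and every measurable $S\subseteq X$ of finite measure. The topology of local convergence in measure on $E$ is the one in which a set $U\subseteq E$ is open if and only if, for every $f\in U$, there are a measurable set $S$ of finite measure and an $\varepsilon>0$ such that every $g\in E$ with $\mu(\{t\in S:|g(t)-f(t)|\geq\varepsilon\})<\varepsilon$ belongs to $U$. In a vector lattice $F$, a net $(x_\alpha)$ is order convergent to $x$ if there is a net $(y_\beta)$ in $F$ with $y_\beta\downarrow 0$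 such that, for every $\beta_0$, there is an $\alpha_0$ with $|x_\alpha-x|\leq y_{\beta_0}$ for all $\alpha\geq\alpha_0$; it is uo-convergent to $x$ if $|x_\alpha-x|\wedge|y|$ is order convergent to $0$ for all $y\in F$. A uo-Lebesgue topology on $F$ is a Hausdorff linear topology on $F$ for which zero has a neighbourhood basis of solid sets and for which every uo-convergent net converges topologically to its uo-limit. $F$ has the countable sup property if every subset of $F$ that has a supremum in $F$ contains an at most countable subset with the same supremum. A sequence $(x_{\alpha_n})_{n\geq 1}$ is embedded in a net $(x_\alpha)_{\alpha\in A}$, where $A$ is a non-empty directed set, if $\alpha_1\leq\alpha_2\leq\alpha_3\leq\dotsc$ in $A$, and moreover $\alpha_1<\alpha_2<\alpha_3<\dotsc$ when $A$ has no largest element. Then the topology of local convergence in measure is a uo-Lebesgue topology on $E$, the convergent nets of which are precisely the nets in $E$ that converge locally in measure to an element of $E$ (with the same limits), and $E$ has the countable sup property. Furthermore: 1. every net in $E$ that converges locally in measure to some $f\in E$ has an embedded sequence that converges to $f$ both almost everywhere and locally in measure; 2. a sequence in $E$ converges locally in measure to $f\in E$ if and only if every subsequence has a further subsequence that converges to $f$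 almost everywhere. -/

import Mathlib

open Filter Topology MeasureTheory

universe u v

/-! ### Vector lattices -/

namespace VectorLattice

/-- Order convergence of a net `x` to `a`: there is a net `y` decreasing to `0` such that, for each
index `b₀` of `y`, eventually `|x i - a| ≤ y b₀`. Index sets of `y` in the universe of `E` suffice,
because only the range of `y` matters. -/
def OrderConverges {E : Type u} [Lattice E] [AddCommGroup E] {A : Type v} [Preorder A]
    (x : A → E) (a : E) : Prop :=
  ∃ (B : Type u) (_ : Preorder B) (_ : IsDirectedOrder B) (_ : Nonempty B) (y : B → E),
    Antitone y ∧ IsGLB (Set.range y) 0 ∧ ∀ b₀ : B, ∃ i₀ : A, ∀ i, i₀ ≤ i → |x i - a| ≤ y b₀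

/-- Unbounded order convergence of a net. -/
def UOConverges {E : Type u} [Lattice E] [AddCommGroup E] {A : Type v} [Preorder A]
    (x : A → E) (a : E) : Prop :=
  ∀ y : E, OrderConverges (fun i => |x i - a| ⊓ |y|) 0

/-- A locally solid topology: a Hausdorff linear topology such that zero has a neighbourhood basis
consisting of solid sets. -/
structure IsLocallySolid {E : Type u} [Lattice E] [AddCommGroup E] [Module ℝ E]
    (τ : TopologicalSpace E) : Prop where
  t2 : T2Space E
  continuousAdd : ContinuousAdd E
  continuousSMul : ContinuousSMul ℝ E
  solid_basis : ∀ U ∈ 𝓝 (0 : E), ∃ V ∈ 𝓝 (0 : E),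
    LatticeOrderedAddCommGroup.IsSolid V ∧ V ⊆ U

/-- A uo-Lebesgue topology: a locally solid topology in which every uo-convergent net converges to
its uo-limit. The nets are those indexed by directed sets in `Type v`. -/
structure IsUOLebesgue.{w₁, w₂} {E : Type w₁} [Lattice E] [AddCommGroup E] [Module ℝ E]
    (τ : TopologicalSpace E) : Prop extends IsLocallySolid τ where
  tendsto_of_uoConverges : ∀ (A : Type w₂) [Preorder A] [IsDirectedOrder A] [Nonempty A]
    (x : A → E) (a : E), UOConverges x a → Tendsto x atTop (𝓝 a)

/-- The countable sup property. -/
def CountableSupProperty (E : Type u) [Lattice E] : Prop :=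
  ∀ (S : Set E) (s : E), IsLUB S s → ∃ T ⊆ S, T.Countable ∧ IsLUB T s

/-- The indices `a 0, a 1, …` define an embedded sequence of every net indexed by `A`: they are
increasing, and strictly increasing when `A` has no largest element. -/
def IsEmbedded {A : Type v} [Preorder A] (a : ℕ → A) : Prop :=
  Monotone a ∧ ((¬ ∃ m : A, IsTop m) → StrictMono a)

end VectorLattice

/-! ### Measure spaces -/

namespace LocalMeasure

variable {X : Type u} [MeasurableSpace X]

/-- A semi-finite measure. -/
def SemiFinite (μ : Measure X) : Prop :=
  ∀ A : Set X, MeasurableSet A → μ A = ⊤ → ∃ A₀ ⊆ A, MeasurableSet A₀ ∧ 0 < μ A₀ ∧ μ A₀ < ⊤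

/-- The support of `f` is a σ-finite set. This does not depend on the representative of `f`, as the
restricted measure does not. -/
def HasSigmaFiniteSupport {μ : Measure X} (f : X →ₘ[μ] ℝ) : Prop :=
  SigmaFinite (μ.restrict (Function.support f))

theorem sigmaFinite_restrict_of_ae_le_union {μ : Measure X} {s t r : Set X}
    (hs : SigmaFinite (μ.restrict s)) (ht : SigmaFinite (μ.restrict t))
    (h : ∀ᵐ x ∂μ, x ∈ r → x ∈ s ∪ t) : SigmaFinite (μ.restrict r) := by
  have h1 : SigmaFinite (μ.restrict s + μ.restrict t) := inferInstance
  exact Measure.sigmaFinite_of_le _ ((Measure.restrict_mono' h le_rfl).trans (Measure.restrict_union_le s t))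

variable (μ : Measure X)

/-- The functions in `L⁰(μ)` with σ-finite support, as a linear subspace of `L⁰(μ)`. It is an ideal
by `mem_of_abs_le`. -/
def E : Submodule ℝ (X →ₘ[μ] ℝ) where
  carrier := {f | HasSigmaFiniteSupport f}
  zero_mem' := by
    have h : μ.restrict (Function.support (0 : X →ₘ[μ] ℝ)) = 0 := by
      rw [Measure.restrict_eq_zero]
      have := AEEqFun.coeFn_zero (α := X) (μ := μ) (β := ℝ)
      exact this
    change SigmaFinite _
    rw [h]
    infer_instance
  add_mem' := by
    intro f g hf hg
    refine sigmaFinite_restrict_of_ae_le_union hf hg ?_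
    filter_upwards [AEEqFun.coeFn_add f g] with x hx hx'
    by_contra hc
    simp only [Set.mem_union, Function.mem_support, not_or, not_not] at hc
    exact hx' (by rw [hx, Pi.add_apply, hc.1, hc.2, add_zero])
  smul_mem' := by
    intro c f hf
    refine sigmaFinite_restrict_of_ae_le_union hf hf ?_
    filter_upwards [AEEqFun.coeFn_smul c f] with x hx hx'
    by_contra hc
    simp only [Set.union_self, Function.mem_support, not_not] at hc
    exact hx' (by rw [hx, Pi.smul_apply, hc, smul_zero])

variable {μ}

theorem mem_E {f : X →ₘ[μ] ℝ} : f ∈ E μ ↔ SigmaFinite (μ.restrict (Function.support f)) := Iff.rfl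

theorem sup_mem {f g : X →ₘ[μ] ℝ} (hf : f ∈ E μ) (hg : g ∈ E μ) : f ⊔ g ∈ E μ := by
  refine sigmaFinite_restrict_of_ae_le_union hf hg ?_
  filter_upwards [AEEqFun.coeFn_sup f g] with x hx hx'
  by_contra hc
  simp only [Set.mem_union, Function.mem_support, not_or, not_not] at hc
  exact hx' (by rw [hx, hc.1, hc.2, sup_idem])

theorem inf_mem {f g : X →ₘ[μ] ℝ} (hf : f ∈ E μ) (hg : g ∈ E μ) : f ⊓ g ∈ E μ := by
  refine sigmaFinite_restrict_of_ae_le_union hf hg ?_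
  filter_upwards [AEEqFun.coeFn_inf f g] with x hx hx'
  by_contra hc
  simp only [Set.mem_union, Function.mem_support, not_or, not_not] at hc
  exact hx' (by rw [hx, hc.1, hc.2, inf_idem])

/-- `E μ` is solid in `L⁰(μ)`, hence an ideal. -/
theorem mem_of_abs_le {f g : X →ₘ[μ] ℝ} (hf : f ∈ E μ) (h : |g| ≤ |f|) : g ∈ E μ := by
  refine sigmaFinite_restrict_of_ae_le_union hf hf ?_
  filter_upwards [AEEqFun.coeFn_abs f, AEEqFun.coeFn_abs g, AEEqFun.coeFn_le.mpr h]
    with x h1 h2 h3 hx'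
  by_contra hc
  simp only [Set.union_self, Function.mem_support, not_not] at hc
  rw [h1, h2, hc, abs_zero] at h3
  exact hx' (abs_nonpos_iff.mp h3)

/-- `E μ` with the order of `L⁰(μ)` (`f ≤ g` almost everywhere) and its lattice operations. -/
instance instLattice : Lattice (E μ) :=
  Subtype.lattice (fun _ _ hf hg => sup_mem hf hg) (fun _ _ hf hg => inf_mem hf hg)

instance instIsOrderedAddMonoid : IsOrderedAddMonoid (E μ) where
  add_le_add_left := by
    intro f g hfg k
    have hfg' : (f : X →ₘ[μ] ℝ) ≤ g := hfg
    change (f : X →ₘ[μ] ℝ) + k ≤ (g : X →ₘ[μ] ℝ) + k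
    rw [← AEEqFun.coeFn_le] at hfg' ⊢
    filter_upwards [AEEqFun.coeFn_add (f : X →ₘ[μ] ℝ) k, AEEqFun.coeFn_add (g : X →ₘ[μ] ℝ) k, hfg']
      with x h1 h2 h3
    rw [h1, h2, Pi.add_apply, Pi.add_apply]
    exact add_le_add h3 le_rfl

instance instPosSMulMono : PosSMulMono ℝ (E μ) where
  smul_le_smul_of_nonneg_left := by
    intro c hc f g hfg
    have hfg' : (f : X →ₘ[μ] ℝ) ≤ g := hfg
    change c • (f : X →ₘ[μ] ℝ) ≤ c • (g : X →ₘ[μ] ℝ)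
    rw [← AEEqFun.coeFn_le] at hfg' ⊢
    filter_upwards [AEEqFun.coeFn_smul c (f : X →ₘ[μ] ℝ), AEEqFun.coeFn_smul c (g : X →ₘ[μ] ℝ), hfg']
      with x h1 h2 h3
    rw [h1, h2, Pi.smul_apply, Pi.smul_apply]
    exact smul_le_smul_of_nonneg_left h3 hc

/-- Local convergence in measure of the net `f` to `g`. -/
def ConvergesLocallyInMeasure {A : Type v} [Preorder A] (f : A → X →ₘ[μ] ℝ) (g : X →ₘ[μ] ℝ) :
    Prop :=
  ∀ ε : ℝ, 0 < ε → ∀ S : Set X, MeasurableSet S → μ S < ⊤ →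
    Tendsto (fun i => μ {t | t ∈ S ∧ ε ≤ |f i t - g t|}) atTop (𝓝 0)

/-- Almost everywhere convergence of the sequence `f` to `g`. -/
def ConvergesAE (f : ℕ → X →ₘ[μ] ℝ) (g : X →ₘ[μ] ℝ) : Prop :=
  ∀ᵐ t ∂μ, Tendsto (fun n => f n t) atTop (𝓝 (g t))

/-- The basic neighbourhood `{g | μ {t ∈ S | |g t - f t| ≥ ε} < ε}` of `f` in `E μ`. -/
def basicNhd (f : E μ) (S : Set X) (ε : ℝ) : Set (E μ) :=
  {g | μ {t | t ∈ S ∧ ε ≤ |(g : X →ₘ[μ] ℝ) t - (f : X →ₘ[μ] ℝ) t|} < ENNReal.ofReal ε}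

theorem basicNhd_mono (f : E μ) {S T : Set X} (hST : S ⊆ T) {ε δ : ℝ} (h : ε ≤ δ) :
    basicNhd f T ε ⊆ basicNhd f S δ := by
  intro g hg
  refine lt_of_le_of_lt (measure_mono ?_) (lt_of_lt_of_le hg (ENNReal.ofReal_le_ofReal h))
  exact fun t ht => ⟨hST ht.1, h.trans ht.2⟩

/-- The topology of local convergence in measure on `E μ`: a set is open if it contains, with each
of its points `f`, a basic neighbourhood of `f` for some `S` of finite measure and some `ε > 0`. -/
abbrev localMeasureTopology (μ : Measure X) : TopologicalSpace (E μ) where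
  IsOpen U := ∀ f ∈ U, ∃ S : Set X, MeasurableSet S ∧ μ S < ⊤ ∧ ∃ ε : ℝ, 0 < ε ∧ basicNhd f S ε ⊆ U
  isOpen_univ := fun _ _ => ⟨∅, MeasurableSet.empty, by simp, 1, one_pos, Set.subset_univ _⟩
  isOpen_inter := by
    intro U V hU hV f hf
    obtain ⟨S, hS, hS', ε, hε, hSU⟩ := hU f hf.1
    obtain ⟨T, hT, hT', δ, hδ, hTV⟩ := hV f hf.2
    refine ⟨S ∪ T, hS.union hT, measure_union_lt_top hS' hT', min ε δ, lt_min hε hδ,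
      Set.subset_inter ?_ ?_⟩
    · exact (basicNhd_mono f Set.subset_union_left (min_le_left _ _)).trans hSU
    · exact (basicNhd_mono f Set.subset_union_right (min_le_right _ _)).trans hTV
  isOpen_sUnion := by
    intro 𝒰 h𝒰 f hf
    obtain ⟨U, hU, hfU⟩ := hf
    obtain ⟨S, hS, hS', ε, hε, hSU⟩ := h𝒰 U hU f hfU
    exact ⟨S, hS, hS', ε, hε, hSU.trans (Set.subset_sUnion_of_mem hU)⟩

end LocalMeasure

/-! Everything rests on the triangle inequality for the deviation sets `{t ∈ S | ε ≤ |f t - g t|}`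
with `μ S < ⊤`. It makes the sets `basicNhd` neighbourhood bases of a locally solid topology, and
semi-finiteness makes this topology Hausdorff.

For the uo-Lebesgue property, testing uo-convergence against `ε • 1_S` reduces matters to a net `y b
↓ 0`. The sets `{t ∈ S | ε ≤ y b t}` decrease modulo null sets, and some countable intersection `K`
of them is an essential lower bound of all (`exists_ae_lowerBound_measure_eq_iInf`). Then `ε • 1_K ≤
y b` for all `b`, so `μ K = 0` and the measures tend to `0`.

For embedded sequences, the space need not be σ-finite, so the set on which almost everywhere
convergence must be forced is the union of the supports of the chosen `f (a m) - g`, which depends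
on the choice. Each new index is therefore chosen to control the deviation on exhausting sets
attached to all earlier ones, and Borel–Cantelli applies. The countable sup property follows by
taking an embedded sequence of the net of finite suprema. -/

namespace LocalMeasure

/-! ### The locally solid topology of local convergence in measure -/

section Topology

variable {X : Type u} [MeasurableSpace X] {μ : Measure X}

theorem measurableSet_deviation (f g : X →ₘ[μ] ℝ) {S : Set X} (hS : MeasurableSet S) (ε : ℝ) :
    MeasurableSet {t | t ∈ S ∧ ε ≤ |f t - g t|} :=
  hS.inter (measurableSet_le measurable_const (f.measurable.sub g.measurable).abs)

theorem measure_deviation_add_le (f g h : X →ₘ[μ] ℝ) (S : Set X) (ε : ℝ) :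
    μ {t | t ∈ S ∧ ε ≤ |f t - h t|} ≤
      μ {t | t ∈ S ∧ ε / 2 ≤ |f t - g t|} + μ {t | t ∈ S ∧ ε / 2 ≤ |g t - h t|} := by
  refine (measure_mono ?_).trans (measure_union_le _ _)
  rintro t ⟨htS, ht⟩
  by_contra hc
  simp only [Set.mem_union, Set.mem_ofPred_eq, htS, true_and, not_or, not_le] at hc
  linarith [abs_sub_le (f t) (g t) (h t)]

theorem mem_basicNhd_self (f : E μ) (S : Set X) {ε : ℝ} (hε : 0 < ε) : f ∈ basicNhd f S ε := by
  have h : {t | t ∈ S ∧ ε ≤ |(f : X →ₘ[μ] ℝ) t - (f : X →ₘ[μ] ℝ) t|} = ∅ := by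
    ext t
    simp [hε]
  change μ _ < _
  rw [h, measure_empty]
  exact ENNReal.ofReal_pos.mpr hε

theorem basicNhd_subset_of_mem {f g : E μ} {S : Set X} {ε : ℝ} (hε : 0 < ε)
    (hg : g ∈ basicNhd f S (ε / 2)) : basicNhd g S (ε / 2) ⊆ basicNhd f S ε := by
  intro h hh
  refine (measure_deviation_add_le (h : X →ₘ[μ] ℝ) g f S ε).trans_lt ?_
  refine (ENNReal.add_lt_add hh hg).trans_le ?_
  rw [← ENNReal.ofReal_add (by positivity) (by positivity), add_halves]

theorem nhds_hasBasis (f : E μ) :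
    (@nhds _ (localMeasureTopology μ) f).HasBasis
      (fun p : Set X × ℝ => MeasurableSet p.1 ∧ μ p.1 < ⊤ ∧ 0 < p.2)
      (fun p => basicNhd f p.1 p.2) := by
  let τ := localMeasureTopology μ
  refine ⟨fun U => ?_⟩
  rw [mem_nhds_iff]
  constructor
  · rintro ⟨V, hVU, hV, hfV⟩
    obtain ⟨S, hS, hS', ε, hε, h⟩ := hV f hfV
    exact ⟨(S, ε), ⟨hS, hS', hε⟩, h.trans hVU⟩
  · rintro ⟨⟨S, ε⟩, ⟨hS, hS', hε⟩, h⟩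
    -- This set is the interior of `U`. Its openness comes from halving the radius, which avoids
    -- showing that basic neighbourhoods are open.
    refine ⟨{g | ∃ T : Set X, MeasurableSet T ∧ μ T < ⊤ ∧ ∃ δ : ℝ, 0 < δ ∧ basicNhd g T δ ⊆ U},
      ?_, ?_, S, hS, hS', ε, hε, h⟩
    · rintro g ⟨T, -, -, δ, hδ, hg⟩
      exact hg (mem_basicNhd_self g T hδ)
    · rintro g ⟨T, hT, hT', δ, hδ, hg⟩
      refine ⟨T, hT, hT', δ / 2, half_pos hδ, fun k hk => ?_⟩
      exact ⟨T, hT, hT', δ / 2, half_pos hδ, (basicNhd_subset_of_mem hδ hk).trans hg⟩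

theorem tendsto_iff_convergesLocallyInMeasure {A : Type v} [Preorder A] (f : A → E μ) (g : E μ) :
    Tendsto f atTop (@nhds _ (localMeasureTopology μ) g) ↔
      ConvergesLocallyInMeasure (fun i => (f i : X →ₘ[μ] ℝ)) g := by
  rw [(nhds_hasBasis g).tendsto_right_iff]
  constructor
  · intro h ε hε S hS hS'
    rw [ENNReal.tendsto_nhds_zero]
    intro δ hδ
    obtain ⟨r, hr, hrδ⟩ : ∃ r : ℝ, 0 < r ∧ ENNReal.ofReal r ≤ δ := by
      obtain ⟨r, hr, hr'⟩ := ENNReal.lt_iff_exists_nnreal_btwn.mp hδ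
      exact ⟨r, by simpa using hr, by simpa using hr'.le⟩
    -- The radius of a basic neighbourhood bounds both the deviation and its measure, hence the
    -- minimum.
    filter_upwards [h (S, min ε r) ⟨hS, hS', lt_min hε hr⟩] with i hi
    refine le_trans ?_ (hi.le.trans ((ENNReal.ofReal_le_ofReal (min_le_right _ _)).trans hrδ))
    exact measure_mono fun t ht => ⟨ht.1, (min_le_left _ _).trans ht.2⟩
  · rintro h ⟨S, ε⟩ ⟨hS, hS', hε⟩
    exact (h ε hε S hS hS').eventually_lt_const (ENNReal.ofReal_pos.mpr hε)

/-- If `|f - g|` were below `1 / (n + 1)` almost everywhere for every `n`, then `f = g`.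
Semi-finiteness then cuts a deviation set of infinite measure down to a finite one; this is its only
use. -/
theorem exists_pos_measure_deviation (hμ : SemiFinite μ) {f g : E μ} (hfg : f ≠ g) :
    ∃ S : Set X, MeasurableSet S ∧ 0 < μ S ∧ μ S < ⊤ ∧
      ∃ ε : ℝ, 0 < ε ∧ ∀ t ∈ S, ε ≤ |(f : X →ₘ[μ] ℝ) t - (g : X →ₘ[μ] ℝ) t| := by
  obtain ⟨n, hn⟩ : ∃ n : ℕ, 0 < μ {t | t ∈ Set.univ ∧
      1 / ((n : ℝ) + 1) ≤ |(f : X →ₘ[μ] ℝ) t - (g : X →ₘ[μ] ℝ) t|} := by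
    by_contra! hc
    refine hfg (Subtype.ext (AEEqFun.ext ?_))
    have h : ∀ n : ℕ, ∀ᵐ t ∂μ, t ∉ {t | t ∈ Set.univ ∧
        1 / ((n : ℝ) + 1) ≤ |(f : X →ₘ[μ] ℝ) t - (g : X →ₘ[μ] ℝ) t|} :=
      fun n => measure_eq_zero_iff_ae_notMem.mp (le_antisymm (hc n) zero_le)
    filter_upwards [ae_all_iff.mpr h] with t ht
    by_contra hne
    obtain ⟨n, hn⟩ := exists_nat_one_div_lt (abs_pos.mpr (sub_ne_zero.mpr hne))
    exact ht n ⟨trivial, hn.le⟩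
  have hm := measurableSet_deviation (f : X →ₘ[μ] ℝ) g MeasurableSet.univ (1 / ((n : ℝ) + 1))
  by_cases htop : μ {t | t ∈ Set.univ ∧
      1 / ((n : ℝ) + 1) ≤ |(f : X →ₘ[μ] ℝ) t - (g : X →ₘ[μ] ℝ) t|} = ⊤
  · obtain ⟨S, hSs, hS, hS0, hS1⟩ := hμ _ hm htop
    exact ⟨S, hS, hS0, hS1, _, by positivity, fun t ht => (hSs ht).2⟩
  · exact ⟨_, hm, hn, lt_top_iff_ne_top.mpr htop, _, by positivity, fun t ht => ht.2⟩

theorem t2Space (hμ : SemiFinite μ) : @T2Space (E μ) (localMeasureTopology μ) := by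
  let τ := localMeasureTopology μ
  refine t2Space_iff_disjoint_nhds.mpr fun f g hfg => ?_
  obtain ⟨S, hS, hS0, hS1, ε, hε, h⟩ := exists_pos_measure_deviation hμ hfg
  have hr : 0 < (μ S).toReal := ENNReal.toReal_pos hS0.ne' hS1.ne
  -- A common point `k` of both neighbourhoods would cover `S` by two sets of measure less than `μ S
  -- / 2`.
  have hδ : 0 < min (ε / 2) ((μ S).toReal / 2) := lt_min (half_pos hε) (half_pos hr)
  refine Filter.disjoint_iff.mpr ⟨_, (nhds_hasBasis f).mem_of_mem (i := (S, _)) ⟨hS, hS1, hδ⟩,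
    _, (nhds_hasBasis g).mem_of_mem (i := (S, _)) ⟨hS, hS1, hδ⟩, ?_⟩
  refine Set.disjoint_left.mpr fun k hk hk' => lt_irrefl (μ S) ?_
  have key : ∀ p : E μ, k ∈ basicNhd p S (min (ε / 2) ((μ S).toReal / 2)) →
      μ {t | t ∈ S ∧ ε / 2 ≤ |(k : X →ₘ[μ] ℝ) t - (p : X →ₘ[μ] ℝ) t|} <
        ENNReal.ofReal ((μ S).toReal / 2) := by
    intro p hp
    refine lt_of_le_of_lt ?_ (lt_of_lt_of_le hp (ENNReal.ofReal_le_ofReal (min_le_right _ _)))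
    exact measure_mono fun t ht => ⟨ht.1, (min_le_left _ _).trans ht.2⟩
  calc μ S ≤ μ {t | t ∈ S ∧ ε ≤ |(f : X →ₘ[μ] ℝ) t - (g : X →ₘ[μ] ℝ) t|} :=
        measure_mono fun t ht => ⟨ht, h t ht⟩
    _ ≤ _ := measure_deviation_add_le (f : X →ₘ[μ] ℝ) k g S ε
    _ < ENNReal.ofReal ((μ S).toReal / 2) + ENNReal.ofReal ((μ S).toReal / 2) := by
        simp_rw [abs_sub_comm ((f : X →ₘ[μ] ℝ) _)]
        exact ENNReal.add_lt_add (key f hk) (key g hk')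
    _ = μ S := by
        rw [← ENNReal.ofReal_add (by positivity) (by positivity), add_halves,
          ENNReal.ofReal_toReal hS1.ne]

theorem continuousAdd : @ContinuousAdd (E μ) (localMeasureTopology μ) _ := by
  let τ := localMeasureTopology μ
  refine ⟨continuous_iff_continuousAt.mpr fun ⟨f, g⟩ => ?_⟩
  rw [ContinuousAt, nhds_prod_eq,
    ((nhds_hasBasis f).prod (nhds_hasBasis g)).tendsto_iff (nhds_hasBasis (f + g))]
  rintro ⟨S, ε⟩ ⟨hS, hS', hε⟩
  refine ⟨((S, ε / 2), (S, ε / 2)), ⟨⟨hS, hS', half_pos hε⟩, hS, hS', half_pos hε⟩, ?_⟩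
  rintro ⟨f', g'⟩ ⟨hf, hg⟩
  change μ _ < _
  refine lt_of_le_of_lt ?_ ((ENNReal.add_lt_add hf hg).trans_le (c := ENNReal.ofReal ε) ?_)
  · refine (measure_mono_ae ?_).trans (measure_union_le _ _)
    filter_upwards [AEEqFun.coeFn_add (f : X →ₘ[μ] ℝ) g, AEEqFun.coeFn_add (f' : X →ₘ[μ] ℝ) g']
      with t h1 h2
    rintro ⟨htS, ht⟩
    by_contra hc
    have hc' := not_or.mp hc
    have hc1 := lt_of_not_ge fun h => hc'.1 ⟨htS, h⟩
    have hc2 := lt_of_not_ge fun h => hc'.2 ⟨htS, h⟩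
    simp only [Submodule.coe_add] at ht
    rw [h1, h2, Pi.add_apply, Pi.add_apply, add_sub_add_comm] at ht
    linarith [abs_add_le ((f' : X →ₘ[μ] ℝ) t - (f : X →ₘ[μ] ℝ) t)
      ((g' : X →ₘ[μ] ℝ) t - (g : X →ₘ[μ] ℝ) t)]
  · rw [← ENNReal.ofReal_add (by positivity) (by positivity), add_halves]

/-- Continuity from above on a set of finite measure. It makes `f` bounded off a small subset of
`S`, as joint continuity of scalar multiplication requires. -/
theorem tendsto_measure_ge_natCast (f : X →ₘ[μ] ℝ) {S : Set X} (hS : MeasurableSet S)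
    (hS' : μ S < ⊤) : Tendsto (fun n : ℕ => μ {t | t ∈ S ∧ (n : ℝ) ≤ |f t|}) atTop (𝓝 0) := by
  have h := tendsto_measure_iInter_atTop (μ := μ) (s := fun n : ℕ => {t | t ∈ S ∧ (n : ℝ) ≤ |f t|})
    (fun n => (hS.inter (measurableSet_le measurable_const f.measurable.abs)).nullMeasurableSet)
    (fun m n hmn t ht => ⟨ht.1, (Nat.cast_le.mpr hmn).trans ht.2⟩)
    ⟨0, ((measure_mono fun t ht => ht.1).trans_lt hS').ne⟩
  have h0 : ⋂ n : ℕ, {t | t ∈ S ∧ (n : ℝ) ≤ |f t|} = ∅ := by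
    refine Set.eq_empty_of_forall_notMem fun t ht => ?_
    obtain ⟨n, hn⟩ := exists_nat_gt |f t|
    exact absurd (Set.mem_iInter.mp ht n).2 (not_le.mpr hn)
  rwa [h0, measure_empty] at h

theorem continuousSMul : @ContinuousSMul ℝ (E μ) _ _ (localMeasureTopology μ) := by
  let τ := localMeasureTopology μ
  refine ⟨continuous_iff_continuousAt.mpr fun ⟨c, f⟩ => ?_⟩
  rw [ContinuousAt, nhds_prod_eq,
    (Metric.nhds_basis_ball.prod (nhds_hasBasis f)).tendsto_iff (nhds_hasBasis (c • f))]
  rintro ⟨S, ε⟩ ⟨hS, hS', hε⟩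
  obtain ⟨n, hn⟩ := ((tendsto_measure_ge_natCast (f : X →ₘ[μ] ℝ) hS hS').eventually_lt_const
    (ENNReal.ofReal_pos.mpr (half_pos hε))).exists
  have hc0 : 0 < |c| + 1 := by positivity
  -- The constants serve the splitting `c' f' - c f = c' (f' - f) + (c' - c) f`: the bound `|c' - c|
  -- < 1` gives `|c'| ≤ |c| + 1`, and `|f| < n` off the small set. Using `n + 1` avoids division by
  -- zero.
  set δ := min (ε / 2) (ε / (2 * (|c| + 1))) with hδ
  have hδ0 : 0 < δ := lt_min (half_pos hε) (by positivity)
  refine ⟨(min 1 (ε / (2 * (n + 1))), (S, δ)), ⟨by positivity, hS, hS', hδ0⟩, ?_⟩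
  rintro ⟨c', f'⟩ ⟨hc, hf⟩
  have hc1 : |c' - c| < 1 := (Metric.mem_ball.mp hc).trans_le (min_le_left _ _)
  have hc2 : |c' - c| < ε / (2 * (n + 1)) := (Metric.mem_ball.mp hc).trans_le (min_le_right _ _)
  change μ _ < _
  have hf' : μ {t | t ∈ S ∧ δ ≤ |(f' : X →ₘ[μ] ℝ) t - (f : X →ₘ[μ] ℝ) t|} <
      ENNReal.ofReal (ε / 2) :=
    lt_of_lt_of_le hf (ENNReal.ofReal_le_ofReal (min_le_left _ _))
  refine lt_of_le_of_lt ?_ ((ENNReal.add_lt_add hf' hn).trans_le (c := ENNReal.ofReal ε) ?_)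
  · refine (measure_mono_ae ?_).trans (measure_union_le _ _)
    filter_upwards [AEEqFun.coeFn_smul c (f : X →ₘ[μ] ℝ), AEEqFun.coeFn_smul c' (f' : X →ₘ[μ] ℝ)]
      with t h1 h2
    rintro ⟨htS, ht⟩
    by_contra hcon
    have hcon' := not_or.mp hcon
    have h3 := lt_of_not_ge fun h => hcon'.1 ⟨htS, h⟩
    have h4 := lt_of_not_ge fun h => hcon'.2 ⟨htS, h⟩
    simp only [Submodule.coe_smul] at ht
    rw [h1, h2, Pi.smul_apply, Pi.smul_apply, smul_eq_mul, smul_eq_mul] at ht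
    have h5 : c' * (f' : X →ₘ[μ] ℝ) t - c * (f : X →ₘ[μ] ℝ) t =
      c' * ((f' : X →ₘ[μ] ℝ) t - (f : X →ₘ[μ] ℝ) t) + (c' - c) * (f : X →ₘ[μ] ℝ) t := by ring
    rw [h5] at ht
    have h6 := ht.trans (abs_add_le _ _)
    rw [abs_mul, abs_mul] at h6
    have h7 : |c'| ≤ |c| + 1 := by
      have := abs_add_le (c' - c) c
      rw [sub_add_cancel] at this
      linarith
    have h8 : |c'| * |(f' : X →ₘ[μ] ℝ) t - (f : X →ₘ[μ] ℝ) t| < ε / 2 := by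
      calc _ ≤ (|c| + 1) * |(f' : X →ₘ[μ] ℝ) t - (f : X →ₘ[μ] ℝ) t| := by gcongr
        _ < (|c| + 1) * (ε / (2 * (|c| + 1))) := by
          gcongr
          exact h3.trans_le (min_le_right _ _)
        _ = ε / 2 := by field_simp
    have h9 : |c' - c| * |(f : X →ₘ[μ] ℝ) t| ≤ ε / 2 := by
      calc _ ≤ ε / (2 * (n + 1)) * (n + 1) := by
            gcongr
            linarith
        _ = ε / 2 := by field_simp
    linarith
  · rw [← ENNReal.ofReal_add (by positivity) (by positivity), add_halves]

theorem isSolid_basicNhd_zero (S : Set X) (ε : ℝ) :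
    LatticeOrderedAddCommGroup.IsSolid (basicNhd (0 : E μ) S ε) := by
  intro f hf g hgf
  have hgf' : |(g : X →ₘ[μ] ℝ)| ≤ |(f : X →ₘ[μ] ℝ)| := hgf
  refine lt_of_le_of_lt (measure_mono_ae ?_) hf
  filter_upwards [AEEqFun.coeFn_abs (f : X →ₘ[μ] ℝ), AEEqFun.coeFn_abs (g : X →ₘ[μ] ℝ),
    AEEqFun.coeFn_le.mpr hgf', AEEqFun.coeFn_zero (α := X) (μ := μ) (β := ℝ)] with t h1 h2 h3 h4
  rintro ⟨htS, ht⟩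
  refine ⟨htS, ht.trans ?_⟩
  rw [h1, h2] at h3
  simpa [h4] using h3

theorem isLocallySolid (hμ : SemiFinite μ) :
    VectorLattice.IsLocallySolid (localMeasureTopology μ) where
  t2 := t2Space hμ
  continuousAdd := continuousAdd
  continuousSMul := continuousSMul
  solid_basis := by
    intro U hU
    obtain ⟨⟨S, ε⟩, h, hU⟩ := (nhds_hasBasis (0 : E μ)).mem_iff.mp hU
    exact ⟨_, (nhds_hasBasis (0 : E μ)).mem_of_mem h, isSolid_basicNhd_zero S ε, hU⟩

end Topology

end LocalMeasure

namespace LocalMeasure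

/-! ### Unbounded order convergence implies local convergence in measure -/

section OrderConvergence

variable {X : Type u} [MeasurableSpace X] {μ : Measure X}

/-- The function with constant value `c` on the set `D` of finite measure, as an element of
`E μ`. -/
noncomputable def indicatorConst {D : Set X} (hD : MeasurableSet D) (hD' : μ D < ⊤) (c : ℝ) :
    E μ :=
  ⟨AEEqFun.mk (D.indicator fun _ => c) (aestronglyMeasurable_const.indicator hD), by
    have h1 : SigmaFinite (μ.restrict D) := by
      have : IsFiniteMeasure (μ.restrict D) := isFiniteMeasure_restrict.mpr hD'.ne
      infer_instance
    refine sigmaFinite_restrict_of_ae_le_union h1 h1 ?_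
    filter_upwards [AEEqFun.coeFn_mk (μ := μ) (D.indicator fun _ => c)
      (aestronglyMeasurable_const.indicator hD)] with x hx hx'
    by_contra hc
    rw [Set.union_self] at hc
    exact hx' (by rw [hx, Set.indicator_of_notMem hc])⟩

theorem coeFn_indicatorConst {D : Set X} (hD : MeasurableSet D) (hD' : μ D < ⊤) (c : ℝ) :
    ⇑(indicatorConst hD hD' c : X →ₘ[μ] ℝ) =ᵐ[μ] D.indicator fun _ => c :=
  AEEqFun.coeFn_mk _ _

theorem coe_le_ae {f g : E μ} (h : f ≤ g) :
    ∀ᵐ t ∂μ, (f : X →ₘ[μ] ℝ) t ≤ (g : X →ₘ[μ] ℝ) t :=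
  AEEqFun.coeFn_le.mpr (show (f : X →ₘ[μ] ℝ) ≤ g from h)

theorem le_of_ae_le {f g : E μ} (h : ∀ᵐ t ∂μ, (f : X →ₘ[μ] ℝ) t ≤ (g : X →ₘ[μ] ℝ) t) : f ≤ g :=
  show (f : X →ₘ[μ] ℝ) ≤ g from AEEqFun.coeFn_le.mp h

/-- A family of sets of finite measure which is downwards directed and antitone up to null sets has
a measurable lower bound whose measure is the infimum of the measures. -/
theorem exists_ae_lowerBound_measure_eq_iInf {B : Type*} [Preorder B] [IsDirectedOrder B]
    [Nonempty B] (D : B → Set X) (hD : ∀ b, MeasurableSet (D b)) (hfin : ∀ b, μ (D b) < ⊤)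
    (hanti : ∀ b c, b ≤ c → D c ≤ᵐ[μ] D b) :
    ∃ K : Set X, MeasurableSet K ∧ μ K = ⨅ b, μ (D b) ∧ ∀ b, K ≤ᵐ[μ] D b := by
  classical
  obtain ⟨c, -, hc, hc'⟩ := exists_seq_tendsto_sInf (Set.range_nonempty fun b => μ (D b))
    (OrderBot.bddBelow _)
  choose b hb using hc'
  have hm : MeasurableSet (⋂ n, D (b n)) := MeasurableSet.iInter fun n => hD _
  have hle : μ (⋂ n, D (b n)) ≤ ⨅ b, μ (D b) := by
    refine ge_of_tendsto' hc fun n => ?_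
    rw [← hb n]
    exact measure_mono (Set.iInter_subset _ n)
  -- Intersecting with any further `D b₀` loses no measure: by directedness, `D b₀` and finitely
  -- many `D (b k)` essentially contain a common `D M`.
  have key : ∀ b₀, ⨅ b, μ (D b) ≤ μ (D b₀ ∩ ⋂ n, D (b n)) := by
    intro b₀
    have h := tendsto_measure_iInter_le (μ := μ) (f := fun n => D b₀ ∩ D (b n))
      (fun n => ((hD _).inter (hD _)).nullMeasurableSet)
      ⟨0, ((measure_mono Set.inter_subset_left).trans_lt (hfin b₀)).ne⟩
    rw [Set.inter_iInter]
    refine ge_of_tendsto' h fun n => ?_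
    obtain ⟨M, hM⟩ := (insert b₀ ((Finset.range (n + 1)).image b)).exists_le
    have hM0 := hM b₀ (Finset.mem_insert_self _ _)
    have hMn : ∀ k ≤ n, b k ≤ M := fun k hk => hM _ (Finset.mem_insert_of_mem
      (Finset.mem_image_of_mem _ (Finset.mem_range.mpr (by omega))))
    refine (iInf_le _ M).trans (measure_mono_ae ?_)
    have h1 : ∀ᵐ t ∂μ, ∀ k, k ≤ n → t ∈ D M → t ∈ D (b k) := by
      refine ae_all_iff.mpr fun k => ?_
      by_cases hk : k ≤ n
      · filter_upwards [hanti _ _ (hMn k hk)] with t ht _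
        exact ht
      · exact ae_of_all _ fun t h => absurd h hk
    filter_upwards [h1, hanti _ _ hM0] with t h1 h2 h3
    exact Set.mem_iInter₂.mpr fun k hk => ⟨h2 h3, h1 k hk h3⟩
  refine ⟨⋂ n, D (b n), hm, le_antisymm hle ?_, fun b₀ => ?_⟩
  · exact (key (Classical.arbitrary B)).trans (measure_mono Set.inter_subset_right)
  · have h : (D b₀ ∩ ⋂ n, D (b n) : Set X) =ᵐ[μ] (⋂ n, D (b n) : Set X) :=
      ae_eq_of_subset_of_measure_ge Set.inter_subset_right (hle.trans (key b₀))
        ((hD b₀).inter hm).nullMeasurableSet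
        (hle.trans_lt ((iInf_le _ b₀).trans_lt (hfin b₀))).ne
    filter_upwards [h.symm.le] with t ht h'
    exact (ht h').1

/-- With `K` the essential lower bound of these sets, `ε • 1_K` lies in `E μ` and below every `y b`,
hence below `0`; so the infimum `μ K` of the measures vanishes. -/
theorem tendsto_measure_of_antitone_of_isGLB_zero {B : Type*} [Preorder B] [IsDirectedOrder B]
    [Nonempty B] {y : B → E μ} (hy : Antitone y) (hy0 : IsGLB (Set.range y) 0) {S : Set X}
    (hS : MeasurableSet S) (hS' : μ S < ⊤) {ε : ℝ} (hε : 0 < ε) :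
    Tendsto (fun b => μ {t | t ∈ S ∧ ε ≤ (y b : X →ₘ[μ] ℝ) t}) atTop (𝓝 0) := by
  have hanti : ∀ b c, b ≤ c → {t | t ∈ S ∧ ε ≤ (y c : X →ₘ[μ] ℝ) t} ≤ᵐ[μ]
      {t | t ∈ S ∧ ε ≤ (y b : X →ₘ[μ] ℝ) t} := by
    intro b c hbc
    filter_upwards [coe_le_ae (hy hbc)] with t ht h
    exact ⟨h.1, h.2.trans ht⟩
  obtain ⟨K, hK, hKμ, hKle⟩ := exists_ae_lowerBound_measure_eq_iInf (μ := μ)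
    (fun b => {t | t ∈ S ∧ ε ≤ (y b : X →ₘ[μ] ℝ) t})
    (fun b => hS.inter (measurableSet_le measurable_const (y b : X →ₘ[μ] ℝ).measurable))
    (fun b => (measure_mono fun t ht => ht.1).trans_lt hS') hanti
  have hK' : μ K < ⊤ := by
    rw [hKμ]
    exact (iInf_le _ (Classical.arbitrary B)).trans_lt
      ((measure_mono fun t ht => ht.1).trans_lt hS')
  have hle : indicatorConst hK hK' ε ≤ 0 := by
    refine hy0.2 ?_
    rintro _ ⟨b, rfl⟩
    refine le_of_ae_le ?_
    filter_upwards [coeFn_indicatorConst hK hK' ε, hKle b, coe_le_ae (hy0.1 ⟨b, rfl⟩),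
      AEEqFun.coeFn_zero (α := X) (μ := μ) (β := ℝ)] with t h1 h2 h3 h4
    rw [h1]
    by_cases ht : t ∈ K
    · rw [Set.indicator_of_mem ht]
      exact (h2 ht).2
    · rw [Set.indicator_of_notMem ht]
      exact h4.symm.le.trans h3
  have hK0 : μ K = 0 := by
    refine measure_eq_zero_iff_ae_notMem.mpr ?_
    filter_upwards [coeFn_indicatorConst hK hK' ε, coe_le_ae hle,
      AEEqFun.coeFn_zero (α := X) (μ := μ) (β := ℝ)] with t h1 h2 h3 ht
    rw [h1, Set.indicator_of_mem ht] at h2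
    exact absurd (h2.trans h3.le) (not_le.mpr hε)
  rw [← hK0, hKμ]
  exact tendsto_atTop_iInf fun b c hbc => measure_mono_ae (hanti b c hbc)

/-- One test element per pair `(S, ε)` suffices: where `|f i - g| ≥ ε` on `S`, its infimum with `ε •
1_S` is still at least `ε`. -/
theorem convergesLocallyInMeasure_of_uoConverges {A : Type v} [Preorder A]
    [IsDirectedOrder A] {f : A → E μ} {g : E μ} (h : VectorLattice.UOConverges f g) :
    ConvergesLocallyInMeasure (fun i => (f i : X →ₘ[μ] ℝ)) g := by
  intro ε hε S hS hS'
  obtain ⟨B, _, _, _, y, hy, hy0, hB⟩ := h (indicatorConst hS hS' ε)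
  rw [ENNReal.tendsto_nhds_zero]
  intro δ hδ
  obtain ⟨b, hb⟩ := ((ENNReal.tendsto_nhds_zero.mp
    (tendsto_measure_of_antitone_of_isGLB_zero hy hy0 hS hS' hε)) δ hδ).exists
  obtain ⟨i₀, hi₀⟩ := hB b
  filter_upwards [eventually_ge_atTop i₀] with i hi
  refine (measure_mono_ae ?_).trans hb
  have h1 := hi₀ i hi
  rw [sub_zero] at h1
  have h2 : |(f i : X →ₘ[μ] ℝ) - (g : X →ₘ[μ] ℝ)| ⊓ |(indicatorConst hS hS' ε : X →ₘ[μ] ℝ)| ≤ (y b : E μ) :=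
    (le_abs_self (|f i - g| ⊓ |indicatorConst hS hS' ε|)).trans h1
  filter_upwards [AEEqFun.coeFn_le.mpr h2, AEEqFun.coeFn_inf |(f i : X →ₘ[μ] ℝ) - (g : X →ₘ[μ] ℝ)|
    |(indicatorConst hS hS' ε : X →ₘ[μ] ℝ)|, AEEqFun.coeFn_abs ((f i : X →ₘ[μ] ℝ) - (g : X →ₘ[μ] ℝ)),
    AEEqFun.coeFn_sub (f i : X →ₘ[μ] ℝ) g, AEEqFun.coeFn_abs
    (indicatorConst hS hS' ε : X →ₘ[μ] ℝ), coeFn_indicatorConst hS hS' ε] with t h3 h4 h5 h6 h7 h8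
  rintro ⟨htS, ht⟩
  refine ⟨htS, le_trans ?_ h3⟩
  rw [h4, h5, h6, h7, h8, Set.indicator_of_mem htS, Pi.sub_apply]
  exact le_inf ht (le_abs_self ε)

theorem isUOLebesgue (hμ : SemiFinite μ) :
    VectorLattice.IsUOLebesgue.{u, v} (localMeasureTopology μ) where
  toIsLocallySolid := isLocallySolid hμ
  tendsto_of_uoConverges := fun _ _ _ _ _ _ h =>
    (tendsto_iff_convergesLocallyInMeasure _ _).mpr (convergesLocallyInMeasure_of_uoConverges h)

end OrderConvergence

/-! ### Embedded sequences, the subsequence criterion and the countable sup property -/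

section Sequences

variable {X : Type u} [MeasurableSpace X] {μ : Measure X}

theorem ConvergesLocallyInMeasure.comp {A B : Type*} [Preorder A] [Preorder B]
    {f : A → X →ₘ[μ] ℝ} {g : X →ₘ[μ] ℝ} (h : ConvergesLocallyInMeasure f g) {φ : B → A}
    (hφ : Tendsto φ atTop atTop) : ConvergesLocallyInMeasure (fun i => f (φ i)) g :=
  fun ε hε S hS hS' => (h ε hε S hS hS').comp hφ

theorem ConvergesAE.convergesLocallyInMeasure {f : ℕ → X →ₘ[μ] ℝ} {g : X →ₘ[μ] ℝ}
    (h : ConvergesAE f g) : ConvergesLocallyInMeasure f g := by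
  intro ε hε S hS hS'
  have : IsFiniteMeasure (μ.restrict S) := isFiniteMeasure_restrict.mpr hS'.ne
  have h1 := tendstoInMeasure_iff_norm.mp (tendstoInMeasure_of_tendsto_ae (μ := μ.restrict S)
    (fun n => (f n).aestronglyMeasurable.restrict) (ae_restrict_of_ae h)) ε hε
  refine h1.congr fun n => ?_
  rw [Measure.restrict_apply' hS]
  congr 1
  ext t
  exact and_comm

/-- In a net, some embedded sequence satisfies countably many eventual conditions, where the
condition on a term may depend on the previous terms. -/
theorem exists_isEmbedded_of_eventually {A : Type v} [Preorder A] [IsDirectedOrder A] [Nonempty A]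
    (P : A → ℕ → A → Prop) (hP : ∀ a n, ∀ᶠ b in atTop, P a n b) :
    ∃ (a : ℕ → A) (k : ℕ → ℕ), VectorLattice.IsEmbedded a ∧ StrictMono k ∧
      ∀ m n, m < n → P (a m) (k n) (a n) := by
  -- The extension principle sees only the finite set of earlier terms, not their number, so a
  -- strictly increasing counter is carried as second component.
  obtain ⟨p, -, hp⟩ := exists_seq_of_forall_finset_exists (α := A × ℕ) (fun _ => True)
    (fun p q => (p.1 ≤ q.1 ∧ ((¬ ∃ m : A, IsTop m) → p.1 < q.1)) ∧ p.2 < q.2 ∧ P p.1 q.2 q.1) (by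
      intro s _
      obtain ⟨n, hn⟩ := (s.image Prod.snd).exists_le
      have h1 : ∀ p ∈ s, ∀ᶠ b in atTop,
          (p.1 ≤ b ∧ ((¬ ∃ m : A, IsTop m) → p.1 < b)) ∧ P p.1 (n + 1) b := by
        intro p _
        refine Eventually.and ?_ (hP _ _)
        by_cases htop : ∃ m : A, IsTop m
        · filter_upwards [eventually_ge_atTop p.1] with b hb
          exact ⟨hb, fun h => absurd htop h⟩
        · obtain ⟨c, hc⟩ : ∃ c, ¬ c ≤ p.1 := by
            by_contra! h
            exact htop ⟨p.1, h⟩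
          filter_upwards [eventually_ge_atTop p.1, eventually_ge_atTop c] with b hb hcb
          exact ⟨hb, fun _ => lt_of_le_not_ge hb fun h => hc (hcb.trans h)⟩
      obtain ⟨b, hb⟩ := ((Finset.eventually_all s).mpr h1).exists
      exact ⟨(b, n + 1), trivial, fun p hps => ⟨(hb p hps).1, Nat.lt_succ_of_le
        (hn _ (Finset.mem_image_of_mem _ hps)), (hb p hps).2⟩⟩)
  refine ⟨fun n => (p n).1, fun n => (p n).2, ⟨?_, ?_⟩, ?_, ?_⟩
  · exact monotone_nat_of_le_succ fun n => (hp n (n + 1) n.lt_succ_self).1.1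
  · exact fun h m n hmn => (hp m n hmn).1.2 h
  · exact fun m n hmn => (hp m n hmn).2.1
  · exact fun m n hmn => (hp m n hmn).2.2

/-- The support of the difference of two elements of `E μ` is exhausted by an increasing sequence of
measurable sets of finite measure. -/
theorem exists_monotone_exhaustion (f g : E μ) :
    ∃ W : ℕ → Set X, Monotone W ∧ (∀ n, MeasurableSet (W n)) ∧ (∀ n, μ (W n) < ⊤) ∧
      ∀ᵐ t ∂μ, (f : X →ₘ[μ] ℝ) t ≠ (g : X →ₘ[μ] ℝ) t → ∃ n, t ∈ W n := by
  set s := Function.support ((f - g : E μ) : X →ₘ[μ] ℝ) with hs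
  have hsm : MeasurableSet s :=
    (AEEqFun.measurable _) (measurableSet_singleton (0 : ℝ)).compl
  have hσ : SigmaFinite (μ.restrict s) := (f - g).2
  refine ⟨fun n => s ∩ spanningSets (μ.restrict s) n,
    fun m n hmn => Set.inter_subset_inter_right _ (monotone_spanningSets _ hmn),
    fun n => hsm.inter (measurableSet_spanningSets _ n), fun n => ?_, ?_⟩
  · have h := measure_spanningSets_lt_top (μ.restrict s) n
    rwa [Measure.restrict_apply' hsm, Set.inter_comm] at h
  · filter_upwards [AEEqFun.coeFn_sub (f : X →ₘ[μ] ℝ) g] with t ht hne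
    have h : t ∈ ⋃ n, spanningSets (μ.restrict s) n := by
      rw [iUnion_spanningSets]
      trivial
    obtain ⟨n, hn⟩ := Set.mem_iUnion.mp h
    refine ⟨n, ?_, hn⟩
    rw [hs, Function.mem_support]
    change ((f : X →ₘ[μ] ℝ) - (g : X →ₘ[μ] ℝ)) t ≠ 0
    rw [ht, Pi.sub_apply]
    exact sub_ne_zero.mpr hne

/-- The term `a n` is chosen so that, for every `m < n`, the deviation from `g` by `2 ^ (-k n)` on
`W (a m) (k n)` has measure below `2 ^ (-k n)`. -/
theorem ConvergesLocallyInMeasure.exists_isEmbedded_convergesAE {A : Type v} [Preorder A]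
    [IsDirectedOrder A] [Nonempty A] {f : A → E μ} {g : E μ}
    (h : ConvergesLocallyInMeasure (fun i => (f i : X →ₘ[μ] ℝ)) g) :
    ∃ a : ℕ → A, VectorLattice.IsEmbedded a ∧
      ConvergesAE (fun n => (f (a n) : X →ₘ[μ] ℝ)) g := by
  choose W hWmono hWm hWfin hW using fun i => exists_monotone_exhaustion (f i) g
  obtain ⟨a, k, ha, hk, hP⟩ := exists_isEmbedded_of_eventually
    (fun i n j => μ {t | t ∈ W i n ∧ (1 / 2 : ℝ) ^ n ≤
      |(f j : X →ₘ[μ] ℝ) t - (g : X →ₘ[μ] ℝ) t|} < (1 / 2) ^ n)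
    (fun i n => (h ((1 / 2) ^ n) (by positivity) (W i n) (hWm i n) (hWfin i n)).eventually_lt_const
      (ENNReal.pow_pos (by simp) n))
  refine ⟨a, ha, ?_⟩
  have hBC : ∀ m N, ∀ᵐ t ∂μ, t ∈ W (a m) N →
      Tendsto (fun n => (f (a n) : X →ₘ[μ] ℝ) t) atTop (𝓝 ((g : X →ₘ[μ] ℝ) t)) := by
    intro m N
    -- From index `M` on, `m` is an earlier stage, and `k (n + M) ≥ N` puts `W (a m) N` inside the
    -- controlled set.
    set M := max (m + 1) N with hM
    have hsum : ∑' n, μ {t | t ∈ W (a m) (k (n + M)) ∧ (1 / 2 : ℝ) ^ k (n + M) ≤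
        |(f (a (n + M)) : X →ₘ[μ] ℝ) t - (g : X →ₘ[μ] ℝ) t|} ≠ ⊤ := by
      have hle : ∀ n, μ {t | t ∈ W (a m) (k (n + M)) ∧ (1 / 2 : ℝ) ^ k (n + M) ≤
          |(f (a (n + M)) : X →ₘ[μ] ℝ) t - (g : X →ₘ[μ] ℝ) t|} ≤ (1 / 2) ^ n := by
        intro n
        refine (hP m (n + M) (by omega)).le.trans
          (pow_le_pow_right_of_le_one' (by simp) ?_)
        exact (Nat.le_add_right n M).trans (hk.id_le _)
      refine ne_top_of_le_ne_top ?_ (ENNReal.tsum_le_tsum hle)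
      rw [ENNReal.tsum_geometric]
      simp
    filter_upwards [ae_eventually_notMem hsum] with t ht htW
    rw [← tendsto_add_atTop_iff_nat M, tendsto_iff_dist_tendsto_zero]
    have hpow : Tendsto (fun n : ℕ => (1 / 2 : ℝ) ^ k (n + M)) atTop (𝓝 0) :=
      (tendsto_pow_atTop_nhds_zero_of_lt_one (by norm_num) (by norm_num)).comp
        (hk.tendsto_atTop.comp (tendsto_add_atTop_nat M))
    refine squeeze_zero' (Eventually.of_forall fun _ => dist_nonneg) ?_ hpow
    filter_upwards [ht] with n hn
    refine le_of_not_ge fun hc => hn ⟨hWmono _ ?_ htW, hc⟩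
    exact ((le_max_right _ _).trans (Nat.le_add_left M n)).trans (hk.id_le _)
  filter_upwards [ae_all_iff.mpr fun m => hW (a m),
    ae_all_iff.mpr fun m => ae_all_iff.mpr (hBC m)] with t h1 h2
  -- A point outside all the supports needs no control: the sequence is constant there.
  by_cases hex : ∃ m, (f (a m) : X →ₘ[μ] ℝ) t ≠ (g : X →ₘ[μ] ℝ) t
  · obtain ⟨m, hm⟩ := hex
    obtain ⟨N, hN⟩ := h1 m hm
    exact h2 m N hN
  · push Not at hex
    simp only [hex]
    exact tendsto_const_nhds

/-- An embedded sequence in `ℕ` is a subsequence. The converse is the subsequence principle for the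
measures, applied for each `ε` and `S` separately. -/
theorem convergesLocallyInMeasure_iff_subseq (f : ℕ → E μ) (g : E μ) :
    ConvergesLocallyInMeasure (fun n => (f n : X →ₘ[μ] ℝ)) g ↔
      ∀ φ : ℕ → ℕ, StrictMono φ → ∃ ψ : ℕ → ℕ, StrictMono ψ ∧
        ConvergesAE (fun n => (f (φ (ψ n)) : X →ₘ[μ] ℝ)) g := by
  constructor
  · intro h φ hφ
    obtain ⟨ψ, hψ, hae⟩ := ConvergesLocallyInMeasure.exists_isEmbedded_convergesAE
      (f := fun n => f (φ n)) (h.comp hφ.tendsto_atTop)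
    exact ⟨ψ, hψ.2 fun ⟨m, hm⟩ => absurd (hm (m + 1)) (by omega), hae⟩
  · intro h ε hε S hS hS'
    refine tendsto_of_subseq_tendsto fun ns hns => ?_
    obtain ⟨θ, hθ, hnθ⟩ := strictMono_subseq_of_tendsto_atTop hns
    obtain ⟨ψ, -, hψ⟩ := h _ hnθ
    exact ⟨fun n => θ (ψ n), hψ.convergesLocallyInMeasure ε hε S hS hS'⟩

theorem countableSupProperty : VectorLattice.CountableSupProperty (E μ) := by
  classical
  intro S s hs
  rcases S.eq_empty_or_nonempty with rfl | ⟨s₀, hs₀⟩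
  · exact ⟨∅, subset_rfl, Set.countable_empty, hs⟩
  -- Nonempty finite sets, since `E μ` need not have a least element to serve as the empty supremum.
  let A := {F : Finset S // F.Nonempty}
  have : Nonempty A := ⟨⟨{⟨s₀, hs₀⟩}, Finset.singleton_nonempty _⟩⟩
  have : IsDirectedOrder A := ⟨fun F G => ⟨⟨F.1 ∪ G.1, F.2.mono Finset.subset_union_left⟩,
    Finset.subset_union_left, Finset.subset_union_right⟩⟩
  let x : A → E μ := fun F => F.1.sup' F.2 Subtype.val
  have hxs : ∀ F, x F ≤ s := fun F => Finset.sup'_le _ _ fun f _ => hs.1 f.2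
  have hglb : IsGLB (Set.range fun F => s - x F) 0 := by
    constructor
    · rintro _ ⟨F, rfl⟩
      exact sub_nonneg.mpr (hxs F)
    · intro z hz
      have h : s ≤ s - z := hs.2 fun f hf => by
        have h1 : z ≤ s - x ⟨{⟨f, hf⟩}, Finset.singleton_nonempty _⟩ := hz ⟨_, rfl⟩
        have h2 : x ⟨{⟨f, hf⟩}, Finset.singleton_nonempty _⟩ = f := Finset.sup'_singleton _
        rw [h2] at h1
        exact le_sub_comm.mp h1
      simpa using h
  have hanti : Antitone fun F => s - x F := fun F G hFG =>
    sub_le_sub_left (Finset.sup'_mono _ hFG F.2) s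
  have hconv : ConvergesLocallyInMeasure (fun F => (x F : X →ₘ[μ] ℝ)) s := by
    intro ε hε T hT hT'
    refine tendsto_of_tendsto_of_tendsto_of_le_of_le tendsto_const_nhds
      (tendsto_measure_of_antitone_of_isGLB_zero hanti hglb hT hT' hε) (fun _ => zero_le)
      fun F => measure_mono_ae ?_
    filter_upwards [coe_le_ae (hxs F), AEEqFun.coeFn_sub (s : X →ₘ[μ] ℝ) (x F)] with t h1 h2
    rintro ⟨htT, ht⟩
    refine ⟨htT, ?_⟩
    change ε ≤ ((s : X →ₘ[μ] ℝ) - (x F : X →ₘ[μ] ℝ)) t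
    rwa [h2, Pi.sub_apply, ← abs_of_nonneg (sub_nonneg.mpr h1), abs_sub_comm]
  obtain ⟨a, -, ha⟩ := hconv.exists_isEmbedded_convergesAE
  refine ⟨⋃ n, Subtype.val '' ((a n).1 : Set S), ?_, ?_, ?_, ?_⟩
  · refine Set.iUnion_subset fun n => ?_
    rintro _ ⟨f, -, rfl⟩
    exact f.2
  · exact Set.countable_iUnion fun n => ((a n).1.finite_toSet.image _).countable
  · intro f hf
    obtain ⟨n, f, -, rfl⟩ := Set.mem_iUnion.mp hf
    exact hs.1 f.2
  · intro z hz
    have h : ∀ n, x (a n) ≤ z := fun n => Finset.sup'_le _ _ fun f hf =>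
      hz (Set.mem_iUnion.mpr ⟨n, f, hf, rfl⟩)
    -- Bounds pass to the almost everywhere limit `s`, as only countably many null sets are
    -- discarded.
    refine le_of_ae_le ?_
    filter_upwards [ha, ae_all_iff.mpr fun n => coe_le_ae (h n)] with t h1 h2
    exact le_of_tendsto' h1 h2

end Sequences

end LocalMeasure

theorem mainTheorem7 {X : Type u} [MeasurableSpace X] (μ : Measure X)
    (hμ : LocalMeasure.SemiFinite μ) :
    -- `E` admits a uo-Lebesgue topology, the topology of local convergence in measure
    VectorLattice.IsUOLebesgue.{u, v} (LocalMeasure.localMeasureTopology μ) ∧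
    (∀ (A : Type v) [Preorder A] [IsDirectedOrder A] [Nonempty A]
      (f : A → LocalMeasure.E μ) (g : LocalMeasure.E μ),
      Tendsto f atTop (@nhds _ (LocalMeasure.localMeasureTopology μ) g) ↔
        LocalMeasure.ConvergesLocallyInMeasure (fun i => (f i : X →ₘ[μ] ℝ)) g) ∧
    VectorLattice.CountableSupProperty (LocalMeasure.E μ) ∧
    -- embedded sequences
    (∀ (A : Type v) [Preorder A] [IsDirectedOrder A] [Nonempty A]
      (f : A → LocalMeasure.E μ) (g : LocalMeasure.E μ),
      LocalMeasure.ConvergesLocallyInMeasure (fun i => (f i : X →ₘ[μ] ℝ)) g →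
        ∃ a : ℕ → A, VectorLattice.IsEmbedded a ∧
          LocalMeasure.ConvergesAE (fun n => (f (a n) : X →ₘ[μ] ℝ)) g ∧
          LocalMeasure.ConvergesLocallyInMeasure (fun n => (f (a n) : X →ₘ[μ] ℝ)) g) ∧
    -- the subsequence criterion
    (∀ (f : ℕ → LocalMeasure.E μ) (g : LocalMeasure.E μ),
      LocalMeasure.ConvergesLocallyInMeasure (fun n => (f n : X →ₘ[μ] ℝ)) g ↔
        ∀ φ : ℕ → ℕ, StrictMono φ → ∃ ψ : ℕ → ℕ, StrictMono ψ ∧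
          LocalMeasure.ConvergesAE (fun n => (f (φ (ψ n)) : X →ₘ[μ] ℝ)) g) :=
  ⟨LocalMeasure.isUOLebesgue hμ,
    fun _ _ _ _ f g => LocalMeasure.tendsto_iff_convergesLocallyInMeasure f g,
    LocalMeasure.countableSupProperty,
    fun _ _ _ _ _ _ h =>
      let ⟨a, ha, hae⟩ := h.exists_isEmbedded_convergesAE
      ⟨a, ha, hae, hae.convergesLocallyInMeasure⟩,
    LocalMeasure.convergesLocallyInMeasure_iff_subseq⟩
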